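/- Let $Q=S^3$ be the group of unit quaternions and let $Q^n=(S^3)^n$ act on $\mathbb H^n$ by componentwise left multiplication (the regular representation). Let $0\le r\le\infty$. A weakly regular atlas of regularity $C^r$ on a topological space $M$ is a family of homeomorphisms $\varphi_\alpha:U_\alpha\to\varphi_\alpha(U_\alpha)$ from open sets $U_\alpha$ covering $M$ onto open subsets of $\mathbb H^n$ such that, for all $\alpha,\beta$ with $U_\alpha\cap U_\beta\neq\emptyset$, the overlap map $\varphi_\alpha\circ\varphi_\beta^{-1}:\varphi_\beta(U_\alpha\cap U_\beta)\to\varphi_\alpha(U_\alpha\cap U_\beta)$ is a $C^r$ diffeomorphism (a homeomorphism if $r=0$) between $Q^n$-invariant open subsets of $\mathbb H^n$ which is $\rho_{\alpha\beta}$-equivariant for some automorphism $\rho_{\alpha\beta}$ of the topological group $Q^n$. Such an atlas represents a local $Q^n$-action on $M$. Its orbit space is $$B_M=\Big(\coprod_\alpha \varphi_\alpha(U_\alpha)/Q^n\Big)\Big/\!\sim$$ with the quotient topology, where $\sim$ identifies the $Q^n$-orbits of $\varphi_\alpha(x)$ and of $\varphi_\beta(x)$ for all $\alpha,\beta$ and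 all $x\in U_\alpha\cap U_\beta$. The orbit map $\pi_M:M\to B_M$ sends $x\in U_\alpha$ to the class of the orbit of $\varphi_\alpha(x)$; it is well defined and continuous. **Proposition 3.3.** Let $M$ be a compact connected Hausdorff space with a local $Q^n$-action given by a weakly regular atlas (so that $M$ is a compact connected $4n$-manifold), with orbit space $B_M$ and orbit map $\pi_M:M\to B_M$. Then for every $x_0\in M$ the induced homomorphism $$(\pi_M)_*:\pi_1(M,x_0)\longrightarrow\pi_1(B_M,\pi_M(x_0))$$ is an isomorphism. -/

import Mathlib

open scoped Quaternion Topology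

noncomputable section

namespace LocalQuaternionic

/-- The quaternionic torus `Qⁿ = (S³)ⁿ`, with `Q = S³` the group of unit quaternions. It carries
the product group structure and the product topology. -/
abbrev QTorus (n : ℕ) : Type := Fin n → Metric.sphere (0 : ℍ[ℝ]) 1

/-- The model space `ℍⁿ`. -/
abbrev HSpace (n : ℕ) : Type := Fin n → ℍ[ℝ]

/-- The regular representation of `Qⁿ` on `ℍⁿ`: componentwise left multiplication. -/
def regularAct {n : ℕ} (q : QTorus n) (x : HSpace n) : HSpace n :=
  fun i => (q i : ℍ[ℝ]) * x i

theorem regularAct_one {n : ℕ} (x : HSpace n) : regularAct 1 x = x := by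
  funext i
  simp [regularAct]

theorem regularAct_mul {n : ℕ} (p q : QTorus n) (x : HSpace n) :
    regularAct (p * q) x = regularAct p (regularAct q x) := by
  funext i
  simp [regularAct, mul_assoc]

/-- A subset of `ℍⁿ` is `Qⁿ`-invariant if it is stable under the regular representation. -/
def IsInvariant {n : ℕ} (s : Set (HSpace n)) : Prop :=
  ∀ (q : QTorus n), ∀ x ∈ s, regularAct q x ∈ s

/-- `e` is a `Cʳ` diffeomorphism (a homeomorphism if `r = 0`) between `Qⁿ`-invariant open subsets
of `ℍⁿ` that is `ρ`-equivariant for some automorphism `ρ` of the topological group `Qⁿ`. -/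
def IsWeaklyEquivariant {n : ℕ} (r : ℕ∞)
    (e : OpenPartialHomeomorph (HSpace n) (HSpace n)) : Prop :=
  IsInvariant e.source ∧ IsInvariant e.target ∧
    ContDiffOn ℝ r e e.source ∧ ContDiffOn ℝ r e.symm e.target ∧
    ∃ ρ : QTorus n ≃ₜ* QTorus n,
      ∀ (q : QTorus n), ∀ x ∈ e.source, e (regularAct q x) = regularAct (ρ q) (e x)

/-- A weakly regular atlas of regularity `Cʳ`, `0 ≤ r ≤ ∞`, on `M`: charts with values in `ℍⁿ`,
covering `M`, whose overlap maps are `Cʳ` diffeomorphisms between invariant open subsets of `ℍⁿ`,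
equivariant up to an automorphism of `Qⁿ`. (For an empty overlap the condition is void.)
Such an atlas represents a local `Qⁿ`-action on `M`. -/
structure WeaklyRegularAtlas (n : ℕ) (r : ℕ∞) (M : Type*) [TopologicalSpace M] where
  charts : Set (OpenPartialHomeomorph M (HSpace n))
  covers : ∀ x : M, ∃ φ ∈ charts, x ∈ φ.source
  overlap : ∀ φ ∈ charts, ∀ ψ ∈ charts, IsWeaklyEquivariant r (ψ.symm.trans φ)

/-- The orbit relation of the regular representation on the image of a chart. -/
def localOrbitSetoid {n : ℕ} {M : Type*} [TopologicalSpace M]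
    (φ : OpenPartialHomeomorph M (HSpace n)) : Setoid φ.target where
  r x y := ∃ q : QTorus n, regularAct q (x : HSpace n) = y
  iseqv :=
    { refl := fun x => ⟨1, regularAct_one _⟩
      symm := by
        rintro x y ⟨q, hq⟩
        exact ⟨q⁻¹, by rw [← hq, ← regularAct_mul, inv_mul_cancel, regularAct_one]⟩
      trans := by
        rintro x y z ⟨q, hq⟩ ⟨p, hp⟩
        exact ⟨p * q, by rw [regularAct_mul, hq, hp]⟩ }

/-- The local orbit space `φ(U) / Qⁿ` of a chart `φ : U → ℍⁿ`, with the quotient topology. -/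
abbrev LocalOrbitSpace {n : ℕ} {M : Type*} [TopologicalSpace M]
    (φ : OpenPartialHomeomorph M (HSpace n)) : Type :=
  Quotient (localOrbitSetoid φ)

/-- The local orbit projection `U → φ(U) → φ(U) / Qⁿ` of a chart `φ`. -/
def localOrbitMap {n : ℕ} {M : Type*} [TopologicalSpace M]
    (φ : OpenPartialHomeomorph M (HSpace n)) (x : φ.source) : LocalOrbitSpace φ :=
  Quotient.mk (localOrbitSetoid φ) ⟨φ x, φ.map_source x.2⟩

namespace WeaklyRegularAtlas

variable {n : ℕ} {r : ℕ∞} {M : Type*} [TopologicalSpace M]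

/-- Two local orbits, one in the chart `φ` and one in the chart `ψ`, are identified if they come
from the same point of the overlap, i.e. correspond to each other under the homeomorphism that the
overlap map `φ ∘ ψ⁻¹` induces on orbits. -/
def orbRel (A : WeaklyRegularAtlas n r M)
    (a b : Σ φ : A.charts, LocalOrbitSpace (φ : OpenPartialHomeomorph M (HSpace n))) : Prop :=
  ∃ (x : M) (hx : x ∈ a.1.1.source) (hx' : x ∈ b.1.1.source),
    a.2 = localOrbitMap a.1.1 ⟨x, hx⟩ ∧ b.2 = localOrbitMap b.1.1 ⟨x, hx'⟩

/-- The orbit space `B_M = (∐ φ(U) / Qⁿ) / ∼`. -/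
def OrbitSpace (A : WeaklyRegularAtlas n r M) : Type _ :=
  Quot A.orbRel

/-- The orbit space carries the quotient topology of the disjoint union topology. -/
instance (A : WeaklyRegularAtlas n r M) : TopologicalSpace A.OrbitSpace :=
  inferInstanceAs (TopologicalSpace (Quot A.orbRel))

/-- The orbit map as a function: the class of the local orbit of `x` in some chart at `x`. -/
def orbitFun (A : WeaklyRegularAtlas n r M) (x : M) : A.OrbitSpace :=
  Quot.mk A.orbRel ⟨⟨(A.covers x).choose, (A.covers x).choose_spec.1⟩,
    localOrbitMap _ ⟨x, (A.covers x).choose_spec.2⟩⟩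

/-- The orbit map may be computed in any chart. -/
theorem orbitFun_eq (A : WeaklyRegularAtlas n r M) (φ : A.charts) (x : φ.1.source) :
    A.orbitFun x = Quot.mk A.orbRel ⟨φ, localOrbitMap φ.1 x⟩ :=
  Quot.sound ⟨x, (A.covers x).choose_spec.2, x.2, rfl, rfl⟩

theorem continuous_orbitFun (A : WeaklyRegularAtlas n r M) : Continuous A.orbitFun := by
  rw [continuous_iff_continuousAt]
  intro x
  obtain ⟨φ, hφ, hx⟩ := A.covers x
  have h : Continuous fun y : φ.source => A.orbitFun y := by
    have h1 : Continuous (localOrbitMap φ) :=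
      continuous_quotient_mk'.comp
        ((continuousOn_iff_continuous_domRestrict.1 φ.continuousOn).subtype_mk _)
    have h2 : Continuous fun b : LocalOrbitSpace φ =>
        (Quot.mk A.orbRel ⟨⟨φ, hφ⟩, b⟩ : A.OrbitSpace) :=
      continuous_quot_mk.comp
        (continuous_sigmaMk (σ := fun φ : A.charts => LocalOrbitSpace φ.1) (i := ⟨φ, hφ⟩))
    exact (h2.comp h1).congr fun y => (A.orbitFun_eq ⟨φ, hφ⟩ y).symm
  exact (continuousOn_iff_continuous_domRestrict.2 h).continuousAt (φ.open_source.mem_nhds hx)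

/-- The orbit map `π_M : M → B_M`. -/
def orbitMap (A : WeaklyRegularAtlas n r M) : C(M, A.OrbitSpace) :=
  ⟨A.orbitFun, A.continuous_orbitFun⟩

end WeaklyRegularAtlas

end LocalQuaternionic

end

/-!
The orbit map `π : M → B` behaves like a fibration with simply connected fibres, except that the
fibres degenerate. An orbit lies in every chart it meets and is a single orbit of `Qⁿ` there
(`exists_regularAct_of_orbitFun_eq`, from the invariance of the overlaps and the equivariance of the
overlap maps). In a chart, `π` is the map `ℍⁿ → [0, ∞)ⁿ` taking norms of coordinates. It has the
section `t ↦ t`, its fibres are path connected, and the preimage of a small box is a product of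
balls and of annuli homotopy equivalent to `S³`, hence simply connected (`isSimplyConnected_box`).

These properties suffice for an isomorphism on `π₁` (`bijective_fundamentalGroup_map`). A path in
`B` is lifted, up to homotopy, by following local sections and correcting the endpoints inside the
fibres; this gives surjectivity. For injectivity let `H` be a null-homotopy of the image of a loop.
Choose arbitrary points of `M` over the points of `H`. Short segments in the square then lift to
paths between the chosen points, and since preimages of small sets are simply connected, the lifts
around a small rectangle cancel. So path classes can be transported across the square from the
constant end of `H` to the given loop (`HasCoherentLift`). Instead of subdivisions of intervals the
arguments use that a transitive relation on `[0, 1]` that holds between nearby points holds always.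

That `S³` is simply connected is proved by covering it with two complements of points
(`simplyConnectedSpace_of_isOpen_union`).
-/

open scoped Quaternion Topology

/-! ### Transport of path classes along a path -/

namespace LocalQuaternionic

open Path
open scoped unitInterval

section Transport

variable {X : Type*} [TopologicalSpace X]

theorem dist_lt_of_mem_uIcc {a b c r : I} {ε : ℝ} (ha : dist a c < ε) (hb : dist b c < ε)
    (hr : r ∈ Set.uIcc a b) : dist r c < ε := by
  rw [Subtype.dist_eq, Real.dist_eq, abs_lt] at *
  rcases Set.mem_uIcc.1 hr with ⟨h1, h2⟩ | ⟨h1, h2⟩ <;>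
    rw [← Subtype.coe_le_coe] at h1 h2 <;> constructor <;> linarith

theorem eventually_uIcc_subset {s : I} {U : Set I} (hU : U ∈ 𝓝 s) :
    ∀ᶠ t in 𝓝 s, Set.uIcc s t ⊆ U := by
  obtain ⟨ε, hε, h⟩ := Metric.mem_nhds_iff.1 hU
  filter_upwards [Metric.ball_mem_nhds s hε] with t ht r hr
  exact h (dist_lt_of_mem_uIcc (by rwa [dist_self]) ht hr)

theorem exists_mem_uIcc_subpath_eq {a b : X} (γ : Path a b) (s t r : I) :
    ∃ u ∈ Set.uIcc s t, γ.subpath s t r = γ u := by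
  have h : γ.subpath s t r ∈ Set.range (γ.subpath s t) := ⟨r, rfl⟩
  rw [Path.range_subpath] at h
  obtain ⟨u, hu, hu'⟩ := h
  exact ⟨u, hu, hu'.symm⟩

theorem trans_apply_mem {S : Set X} {a b c : X} {p : Path a b} {q : Path b c} (hp : ∀ t, p t ∈ S)
    (hq : ∀ t, q t ∈ S) (t : I) : p.trans q t ∈ S := by
  rw [Path.trans_apply]
  split_ifs
  exacts [hp _, hq _]

theorem _root_.IsSimplyConnected.mk_eq_mk {S : Set X} (hS : IsSimplyConnected S) {x y : X}
    {p q : Path x y} (hp : ∀ t, p t ∈ S) (hq : ∀ t, q t ∈ S) :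
    Homotopic.Quotient.mk p = .mk q := by
  have := hS.simplyConnectedSpace
  let p' : Path (⟨x, by simpa using hp 0⟩ : S) ⟨y, by simpa using hp 1⟩ :=
    ⟨⟨fun t => ⟨p t, hp t⟩, by fun_prop⟩, by simp, by simp⟩
  let q' : Path (⟨x, by simpa using hp 0⟩ : S) ⟨y, by simpa using hp 1⟩ :=
    ⟨⟨fun t => ⟨q t, hq t⟩, by fun_prop⟩, by simp, by simp⟩
  exact Homotopic.Quotient.eq.2
    ((SimplyConnectedSpace.paths_homotopic p' q').map ⟨_, continuous_subtype_val⟩)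

/-- A family of path classes from a base point to the points of a path `γ` that is compatible with
`γ` near each time is compatible with `γ` globally, because `[0, 1]` is connected. -/
theorem trans_subpath_of_local {a b z : X} (γ : Path a b) (h : ∀ t, Homotopic.Quotient z (γ t))
    (hloc : ∀ s, ∀ᶠ t in 𝓝 s, (h s).trans (.mk (γ.subpath s t)) = h t) (s t : I) :
    (h s).trans (.mk (γ.subpath s t)) = h t := by
  refine PreconnectedSpace.induction₂' (fun s t => (h s).trans (.mk (γ.subpath s t)) = h t)
    (fun s => ?_) ⟨fun s t u hst htu => ?_⟩ s t
  · filter_upwards [hloc s] with t ht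
    refine ⟨ht, ?_⟩
    rw [← ht, ← Path.symm_subpath γ s t]
    simp only [Homotopic.Quotient.mk_symm, Homotopic.Quotient.trans_assoc,
      Homotopic.Quotient.trans_symm, Homotopic.Quotient.trans_refl]
  · have key : (Homotopic.Quotient.mk (γ.subpath s t)).trans (.mk (γ.subpath t u)) =
        .mk (γ.subpath s u) :=
      Homotopic.Quotient.eq.2 ⟨Path.Homotopy.subpathTransSubpath γ s t u⟩
    rw [← key, ← htu, ← hst, Homotopic.Quotient.trans_assoc]

theorem trans_mk_cast_eq {z a b a' b' : X} {p : Path z a'} {q : Path a b} {p' : Path z b'}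
    (ha : a' = a) (hb : b' = b)
    (h : (Homotopic.Quotient.mk p).trans (.mk (q.cast ha hb)) = .mk p') :
    (Homotopic.Quotient.mk (p.cast rfl ha.symm)).trans (.mk q) = .mk (p'.cast rfl hb.symm) := by
  subst ha hb
  exact h

/-- A weak form of the Seifert–van Kampen theorem: a space is simply connected if it is the union
of two simply connected open sets with path connected intersection. -/
theorem simplyConnectedSpace_of_isOpen_union {U V : Set X} (hU : IsOpen U) (hV : IsOpen V)
    (hUV : U ∪ V = Set.univ) (hU' : IsSimplyConnected U) (hV' : IsSimplyConnected V)
    (hI : IsPathConnected (U ∩ V)) : SimplyConnectedSpace X := by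
  obtain ⟨z, hz⟩ := hI.nonempty
  -- The connecting path `c x` stays in each of `U`, `V` that contains `x`.
  have hc : ∀ x, ∃ p : Path z x, (x ∈ U → ∀ t, p t ∈ U) ∧ (x ∈ V → ∀ t, p t ∈ V) := by
    intro x
    by_cases hxU : x ∈ U <;> by_cases hxV : x ∈ V
    · obtain ⟨p, hp⟩ := hI.joinedIn z hz x ⟨hxU, hxV⟩
      exact ⟨p, fun _ t => (hp t).1, fun _ t => (hp t).2⟩
    · obtain ⟨p, hp⟩ := hU'.isPathConnected.joinedIn z hz.1 x hxU
      exact ⟨p, fun _ t => hp t, fun h => absurd h hxV⟩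
    · obtain ⟨p, hp⟩ := hV'.isPathConnected.joinedIn z hz.2 x hxV
      exact ⟨p, fun h => absurd h hxU, fun _ t => hp t⟩
    · exact absurd (hUV ▸ Set.mem_univ x : x ∈ U ∪ V) (by simp [hxU, hxV])
  choose c hcU hcV using hc
  rw [simply_connected_iff_loops_nullhomotopic]
  refine ⟨⟨⟨z⟩, fun x y => ⟨(c x).symm.trans (c y)⟩⟩, fun x γ => ?_⟩
  have hloc : ∀ s, ∀ᶠ t in 𝓝 s,
      (Homotopic.Quotient.mk (c (γ s))).trans (.mk (γ.subpath s t)) = .mk (c (γ t)) := by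
    have main : ∀ {S : Set X}, IsOpen S → IsSimplyConnected S → (∀ x, x ∈ S → ∀ t, c x t ∈ S) →
        ∀ s, γ s ∈ S → ∀ᶠ t in 𝓝 s,
          (Homotopic.Quotient.mk (c (γ s))).trans (.mk (γ.subpath s t)) = .mk (c (γ t)) := by
      intro S hS hS' hcS s hs
      filter_upwards [eventually_uIcc_subset ((hS.preimage γ.continuous).mem_nhds hs)] with t ht
      rw [← Homotopic.Quotient.mk_trans]
      refine hS'.mk_eq_mk (trans_apply_mem (hcS _ hs) fun r => ?_) (hcS _ (ht Set.right_mem_uIcc))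
      obtain ⟨u, hu, hu'⟩ := exists_mem_uIcc_subpath_eq γ s t r
      exact hu' ▸ ht hu
    intro s
    rcases (hUV ▸ Set.mem_univ (γ s) : γ s ∈ U ∪ V) with hs | hs
    exacts [main hU hU' hcU s hs, main hV hV' hcV s hs]
  have h01 := trans_subpath_of_local γ (fun t => .mk (c (γ t))) hloc 0 1
  rw [Path.subpath_zero_one] at h01
  have h := trans_mk_cast_eq γ.source γ.target h01
  have hcast : (c (γ 0)).cast rfl γ.source.symm = (c (γ 1)).cast rfl γ.target.symm := by
    have : ∀ y y' (hy : x = y) (hy' : x = y'), (c y).cast rfl hy = (c y').cast rfl hy' := by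
      rintro _ _ rfl rfl
      rfl
    exact this _ _ _ _
  rw [hcast] at h
  refine Homotopic.Quotient.eq.1 ?_
  have h' := congrArg (fun e =>
    (Homotopic.Quotient.symm (.mk ((c (γ 1)).cast rfl γ.target.symm))).trans e) h
  simpa [← Homotopic.Quotient.trans_assoc] using h'

end Transport

end LocalQuaternionic

/-! ### Maps with simply connected fibres and local sections -/

namespace LocalQuaternionic

open Path
open scoped unitInterval

section SimpleOver

variable {X Y : Type*} [TopologicalSpace X] [TopologicalSpace Y]

/-- `f` has a continuous section over `W` (encoded as a function on the whole base), and paths over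
`W` are determined up to homotopy in the total space by their endpoints. -/
structure IsSimpleOver (f : C(X, Y)) (W : Set Y) : Prop where
  exists_section : ∃ sec : Y → X, ContinuousOn sec W ∧ ∀ w ∈ W, f (sec w) = w
  mk_eq_mk : ∀ {x x' : X} {p q : Path x x'}, (∀ t, f (p t) ∈ W) → (∀ t, f (q t) ∈ W) →
    Homotopic.Quotient.mk p = .mk q

/-- Adding constant paths at both ends of `γ` does not change its homotopy class. The endpoints of
the constant paths are equal only propositionally. -/
theorem homotopic_of_const {a b c d : Y} (p : Path a b) (γ : Path b c) (q : Path c d)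
    (γ' : Path a d) (hp : ∀ t, p t = a) (hq : ∀ t, q t = d) (hγ : ∀ t, γ t = γ' t) :
    ((p.trans γ).trans q).Homotopic γ' := by
  obtain rfl : b = a := by rw [← hp 1, p.target]
  obtain rfl : c = d := by rw [← hq 0, q.source]
  obtain rfl : p = Path.refl b := Path.ext (funext hp)
  obtain rfl : q = Path.refl c := Path.ext (funext hq)
  obtain rfl : γ = γ' := Path.ext (funext hγ)
  exact (Homotopic.trans_refl _).trans (Homotopic.refl_trans _)

variable {f : C(X, Y)}

/-- Path lifting with prescribed endpoints: move along the fibre to the section, follow the section,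
and return along the fibre. The image of the lift is `γ` with pauses at both ends. -/
theorem IsSimpleOver.exists_lift
    (hfib : ∀ x x' : X, f x = f x' → ∃ p : Path x x', ∀ t, f (p t) = f x)
    {W : Set Y} (hW : IsSimpleOver f W) {x x' : X} (γ : Path (f x) (f x')) (hγ : ∀ t, γ t ∈ W) :
    ∃ q : Path x x', (∀ t, ∃ s, f (q t) = γ s) ∧ (q.map f.continuous).Homotopic γ := by
  obtain ⟨sec, hsec, hsec'⟩ := hW.exists_section
  have h0 : f x = f (sec (γ 0)) := by rw [hsec' _ (hγ 0), γ.source]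
  have h1 : f (sec (γ 1)) = f x' := by rw [hsec' _ (hγ 1), γ.target]
  obtain ⟨p, hp⟩ := hfib _ _ h0
  obtain ⟨q, hq⟩ := hfib _ _ h1
  let m : Path (sec (γ 0)) (sec (γ 1)) :=
    ⟨⟨fun t => sec (γ t), hsec.comp_continuous γ.continuous hγ⟩, rfl, rfl⟩
  refine ⟨(p.trans m).trans q, fun t => ?_, ?_⟩
  · have hp' : ∀ t, p t ∈ {z | ∃ s, f z = γ s} := fun t => ⟨0, by rw [hp, γ.source]⟩
    have hm' : ∀ t, m t ∈ {z | ∃ s, f z = γ s} := fun t => ⟨t, hsec' _ (hγ t)⟩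
    have hq' : ∀ t, q t ∈ {z | ∃ s, f z = γ s} := fun t => ⟨1, by rw [hq, h1, γ.target]⟩
    exact trans_apply_mem (trans_apply_mem hp' hm') hq' t
  · rw [Path.map_trans, Path.map_trans]
    exact homotopic_of_const _ _ _ _ hp (fun t => (hq t).trans h1) fun t => hsec' _ (hγ t)

/-- Every path in the base lifts, up to homotopy, to a path with prescribed endpoints. -/
theorem exists_lift_of_isSimpleOver (hsurj : Function.Surjective f)
    (hfib : ∀ x x' : X, f x = f x' → ∃ p : Path x x', ∀ t, f (p t) = f x)
    (hloc : ∀ y, ∃ W, IsOpen W ∧ y ∈ W ∧ IsSimpleOver f W) {x x' : X} (γ : Path (f x) (f x')) :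
    ∃ q : Path x x', (q.map f.continuous).Homotopic γ := by
  have key : ∀ s t : I, ∀ z z' : X, ∀ (hz : f z = γ s) (hz' : f z' = γ t),
      ∃ q : Path z z', (q.map f.continuous).Homotopic ((γ.subpath s t).cast hz hz') := by
    intro s t
    refine PreconnectedSpace.induction₂' (fun s t : I => ∀ z z' : X, ∀ (hz : f z = γ s)
      (hz' : f z' = γ t), ∃ q : Path z z', (q.map f.continuous).Homotopic
        ((γ.subpath s t).cast hz hz')) (fun s => ?_) ⟨fun s t u hst htu z z' hz hz' => ?_⟩ s t
    · obtain ⟨W, hWo, hsW, hW⟩ := hloc (γ s)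
      filter_upwards [eventually_uIcc_subset ((hWo.preimage γ.continuous).mem_nhds hsW)] with t ht
      constructor
      · intro z z' hz hz'
        obtain ⟨q, -, hq⟩ := hW.exists_lift hfib ((γ.subpath s t).cast hz hz') fun r => by
          obtain ⟨u, hu, hu'⟩ := exists_mem_uIcc_subpath_eq γ s t r
          rw [Path.cast_coe, hu']
          exact ht hu
        exact ⟨q, hq⟩
      · intro z z' hz hz'
        obtain ⟨q, -, hq⟩ := hW.exists_lift hfib ((γ.subpath t s).cast hz hz') fun r => by
          obtain ⟨u, hu, hu'⟩ := exists_mem_uIcc_subpath_eq γ t s r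
          rw [Path.cast_coe, hu']
          exact ht (Set.uIcc_comm t s ▸ hu)
        exact ⟨q, hq⟩
    · obtain ⟨y, hy⟩ := hsurj (γ t)
      obtain ⟨q, hq⟩ := hst z y hz hy
      obtain ⟨q', hq'⟩ := htu y z' hy hz'
      refine ⟨q.trans q', ?_⟩
      rw [Path.map_trans]
      refine (hq.hcomp hq').trans ?_
      rw [← Path.cast_trans]
      exact Homotopic.pathCast ⟨Homotopy.subpathTransSubpath γ s t u⟩ hz hz'
  obtain ⟨q, hq⟩ := key 0 1 x x' γ.source.symm γ.target.symm
  refine ⟨q, ?_⟩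
  rwa [Path.subpath_zero_one] at hq

/-- Points over `H u` and `H v` are joined by a path lying over the image of the rectangle with
opposite corners `u` and `v`, if that rectangle is mapped into `W`. -/
theorem IsSimpleOver.exists_lift_segment
    (hfib : ∀ x x' : X, f x = f x' → ∃ p : Path x x', ∀ t, f (p t) = f x)
    {W : Set Y} (hW : IsSimpleOver f W) (H : C(I × I, Y)) {u v : I × I}
    (hH : ∀ w, w.1 ∈ Set.uIcc u.1 v.1 → w.2 ∈ Set.uIcc u.2 v.2 → H w ∈ W) {x x' : X}
    (hx : f x = H u) (hx' : f x' = H v) :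
    ∃ q : Path x x', ∀ r, ∃ w : I × I, w.1 ∈ Set.uIcc u.1 v.1 ∧ w.2 ∈ Set.uIcc u.2 v.2 ∧
      f (q r) = H w := by
  let e : Path (0 : I) 1 := ⟨⟨id, continuous_id⟩, rfl, rfl⟩
  let γ : Path (H u) (H v) :=
    ((e.subpath u.1 v.1).prod (e.subpath u.2 v.2)).map H.continuous
  have hγ : ∀ r, ∃ w : I × I, w.1 ∈ Set.uIcc u.1 v.1 ∧ w.2 ∈ Set.uIcc u.2 v.2 ∧ γ r = H w := by
    intro r
    obtain ⟨a, ha, ha'⟩ := exists_mem_uIcc_subpath_eq e u.1 v.1 r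
    obtain ⟨b, hb, hb'⟩ := exists_mem_uIcc_subpath_eq e u.2 v.2 r
    exact ⟨(a, b), ha, hb, congrArg H (Prod.ext ha' hb')⟩
  obtain ⟨q, hq, -⟩ := hW.exists_lift hfib (γ.cast hx hx') fun r => by
    obtain ⟨w, h1, h2, h3⟩ := hγ r
    rw [Path.cast_coe, h3]
    exact hH w h1 h2
  refine ⟨q, fun r => ?_⟩
  obtain ⟨s, hs⟩ := hq r
  obtain ⟨w, h1, h2, h3⟩ := hγ s
  exact ⟨w, h1, h2, hs.trans h3⟩

variable (f) in
/-- A coherent family of path classes over the path `H (t, ·)`: whenever the points `g s` lie over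
`H (t, s)`, there are path classes from `z` to the `g s` compatible with all short paths over
`H (t, ·)`, and the classes at the two ends come from the fibre of `f z`. The family `g` is an
arbitrary set-theoretic lift, so that no lift of `H (t, ·)` as a path has to be chosen. -/
def HasCoherentLift (z : X) (H : C(I × I, Y)) (t : I) : Prop :=
  ∀ g : I → X, (∀ s, f (g s) = H (t, s)) → ∃ h : ∀ s, Homotopic.Quotient z (g s),
    (∀ s₀, ∀ᶠ s in 𝓝 s₀, ∀ p : Path (g s₀) (g s),
      (∀ r, ∃ s' ∈ Set.uIcc s₀ s, f (p r) = H (t, s')) → (h s₀).trans (.mk p) = h s) ∧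
    (∃ p : Path z (g 0), (∀ r, f (p r) = f z) ∧ h 0 = .mk p) ∧
    ∃ p : Path z (g 1), (∀ r, f (p r) = f z) ∧ h 1 = .mk p

theorem hasCoherentLift_of_const
    (hfib : ∀ x x' : X, f x = f x' → ∃ p : Path x x', ∀ t, f (p t) = f x)
    (hloc : ∀ y, ∃ W, IsOpen W ∧ y ∈ W ∧ IsSimpleOver f W)
    {z : X} {H : C(I × I, Y)} {t : I} (hH : ∀ s, H (t, s) = f z) : HasCoherentLift f z H t := by
  intro g hg
  choose p hp using fun s => hfib z (g s) ((hg s).trans (hH s)).symm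
  obtain ⟨W, -, hzW, hW⟩ := hloc (f z)
  refine ⟨fun s => .mk (p s), fun s₀ => .of_forall fun s q hq => ?_, ⟨p 0, hp 0, rfl⟩,
    ⟨p 1, hp 1, rfl⟩⟩
  rw [← Homotopic.Quotient.mk_trans]
  refine hW.mk_eq_mk (trans_apply_mem (S := f ⁻¹' W) (fun r => ?_) fun r => ?_) fun r => ?_
  · rw [Set.mem_preimage, hp]
    exact hzW
  · obtain ⟨s', -, hs'⟩ := hq r
    rw [Set.mem_preimage, hs', hH]
    exact hzW
  · rw [hp]
    exact hzW

/-- A coherent family over `H (t, ·)` is moved to `H (t', ·)` along the segments `[t, t'] × {s}`,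
if `t'` is so close to `t` that `H` maps squares of this size into sets over which `f` is simple. -/
theorem HasCoherentLift.of_dist_lt (hsurj : Function.Surjective f)
    (hfib : ∀ x x' : X, f x = f x' → ∃ p : Path x x', ∀ t, f (p t) = f x)
    {z : X} {H : C(I × I, Y)} {δ : ℝ} (hδ : 0 < δ)
    (hball : ∀ u : I × I, ∃ W, IsSimpleOver f W ∧ ∀ w ∈ Metric.ball u δ, H w ∈ W)
    (hH0 : ∀ t, H (t, 0) = f z) (hH1 : ∀ t, H (t, 1) = f z)
    {t t' : I} (htt : dist t' t < δ) (ht : HasCoherentLift f z H t) :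
    HasCoherentLift f z H t' := by
  intro g' hg'
  choose g hg using fun s => hsurj (H (t, s))
  obtain ⟨h, hh, ⟨p0, hp0, hp0'⟩, p1, hp1, hp1'⟩ := ht g hg
  choose W hW hball using hball
  have hself : dist t t < δ := by rwa [dist_self]
  have mem : ∀ {s₀ a b}, dist a t < δ → dist b s₀ < δ → H (a, b) ∈ W (t, s₀) := fun ha hb =>
    hball _ _ (by rw [Metric.mem_ball, Prod.dist_eq]; exact max_lt ha hb)
  have hv : ∀ s, ∃ q : Path (g s) (g' s), ∀ r, ∃ a ∈ Set.uIcc t t', f (q r) = H (a, s) := by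
    intro s
    obtain ⟨q, hq⟩ := (hW (t, s)).exists_lift_segment hfib H (u := (t, s)) (v := (t', s))
      (fun w h1 h2 => mem (dist_lt_of_mem_uIcc hself htt h1) (by
        rw [Set.uIcc_self, Set.mem_singleton_iff] at h2
        rwa [h2, dist_self])) (hg s) (hg' s)
    refine ⟨q, fun r => ?_⟩
    obtain ⟨⟨a, b⟩, ha, hb, hab⟩ := hq r
    rw [Set.uIcc_self, Set.mem_singleton_iff] at hb
    obtain rfl : b = s := hb
    exact ⟨a, ha, hab⟩
  choose v hv using hv
  have hend : ∀ s, (∀ t, H (t, s) = f z) → ∀ p : Path z (g s), (∀ r, f (p r) = f z) →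
      ∀ r, f ((p.trans (v s)) r) = f z := fun s hs p hp =>
    trans_apply_mem (S := f ⁻¹' {f z}) hp fun r => by
      obtain ⟨a, -, ha⟩ := hv s r
      exact ha.trans (hs a)
  refine ⟨fun s => (h s).trans (.mk (v s)), fun s₀ => ?_,
    ⟨p0.trans (v 0), hend 0 hH0 p0 hp0, congrArg (fun e => e.trans (.mk (v 0))) hp0'⟩,
    ⟨p1.trans (v 1), hend 1 hH1 p1 hp1, congrArg (fun e => e.trans (.mk (v 1))) hp1'⟩⟩
  filter_upwards [hh s₀, Metric.ball_mem_nhds s₀ hδ] with s hs hs' p' hp'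
  have hs₀ : dist s₀ s₀ < δ := by rwa [dist_self]
  obtain ⟨p, hp⟩ := (hW (t, s₀)).exists_lift_segment hfib H (u := (t, s₀)) (v := (t, s))
    (fun w h1 h2 => mem (dist_lt_of_mem_uIcc hself hself h1) (dist_lt_of_mem_uIcc hs₀ hs' h2))
    (hg s₀) (hg s)
  rw [← hs p fun r => by
    obtain ⟨⟨a, b⟩, ha, hb, hab⟩ := hp r
    rw [Set.uIcc_self, Set.mem_singleton_iff] at ha
    obtain rfl : a = t := ha
    exact ⟨b, hb, hab⟩, Homotopic.Quotient.trans_assoc, Homotopic.Quotient.trans_assoc,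
    ← Homotopic.Quotient.mk_trans, ← Homotopic.Quotient.mk_trans]
  congr 1
  -- Both ways around the rectangle `[t, t'] × [s₀, s]` stay over `W (t, s₀)`.
  have hvmem : ∀ b, dist b s₀ < δ → ∀ r, v b r ∈ f ⁻¹' W (t, s₀) := by
    intro b hb r
    obtain ⟨a, ha, ha'⟩ := hv b r
    rw [Set.mem_preimage, ha']
    exact mem (dist_lt_of_mem_uIcc hself htt ha) hb
  refine (hW (t, s₀)).mk_eq_mk (trans_apply_mem (hvmem s₀ hs₀) fun r => ?_)
    (trans_apply_mem (S := f ⁻¹' W (t, s₀)) (fun r => ?_) (hvmem s hs'))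
  · obtain ⟨b, hb, hb'⟩ := hp' r
    rw [Set.mem_preimage, hb']
    exact mem htt (dist_lt_of_mem_uIcc hs₀ hs' hb)
  · obtain ⟨⟨a, b⟩, ha, hb, hab⟩ := hp r
    rw [Set.mem_preimage, hab]
    exact mem (dist_lt_of_mem_uIcc hself hself ha) (dist_lt_of_mem_uIcc hs₀ hs' hb)

/-- Given a null-homotopy `H` of the image of a loop `γ`, the constant paths are a coherent family
over the constant end of `H`; moved through `H`, it becomes a family of path classes along `γ` that
starts and ends with loops in one fibre, so `γ` is null-homotopic. -/
theorem homotopic_refl_of_map_homotopic_refl (hsurj : Function.Surjective f)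
    (hfib : ∀ x x' : X, f x = f x' → ∃ p : Path x x', ∀ t, f (p t) = f x)
    (hloc : ∀ y, ∃ W, IsOpen W ∧ y ∈ W ∧ IsSimpleOver f W) {z : X} (γ : Path z z)
    (hγ : (γ.map f.continuous).Homotopic (Path.refl (f z))) : γ.Homotopic (Path.refl z) := by
  obtain ⟨F⟩ := hγ
  let H : C(I × I, Y) := F.toContinuousMap
  choose W hWo hmem hW using hloc
  -- `δ` is a Lebesgue number for the preimages under `H` of the sets over which `f` is simple.
  obtain ⟨δ, hδ, hball⟩ := lebesgue_number_lemma_of_metric (isCompact_univ (X := I × I))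
    (c := fun y => H ⁻¹' W y) (fun y => (hWo y).preimage H.continuous)
    fun u _ => Set.mem_iUnion.2 ⟨H u, hmem _⟩
  have hball' : ∀ u : I × I, ∃ W, IsSimpleOver f W ∧ ∀ w ∈ Metric.ball u δ, H w ∈ W := by
    intro u
    obtain ⟨y, hy⟩ := hball u trivial
    exact ⟨W y, hW y, fun w hw => hy hw⟩
  have hH0 : ∀ t, H (t, 0) = f z := F.source
  have hH1 : ∀ t, H (t, 1) = f z := F.target
  have step : HasCoherentLift f z H 1 → HasCoherentLift f z H 0 := by
    refine PreconnectedSpace.induction₂'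
      (fun t t' : I => HasCoherentLift f z H t → HasCoherentLift f z H t') (fun t => ?_)
      ⟨fun _ _ _ h h' => h' ∘ h⟩ 1 0
    filter_upwards [Metric.ball_mem_nhds t hδ] with t' ht'
    exact ⟨HasCoherentLift.of_dist_lt hsurj hfib hδ hball' hH0 hH1 ht',
      HasCoherentLift.of_dist_lt hsurj hfib hδ hball' hH0 hH1 (by rwa [dist_comm])⟩
  have hγ0 : ∀ s, f (γ s) = H (0, s) := fun s => (F.apply_zero s).symm
  obtain ⟨h, hh, ⟨p0, hp0, hp0'⟩, p1, hp1, hp1'⟩ := step (hasCoherentLift_of_const hfib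
    (fun y => ⟨W y, hWo y, hmem y, hW y⟩) fun s => F.apply_one s) γ hγ0
  have h01 := trans_subpath_of_local γ h (fun s => (hh s).mono fun t ht => ht _ fun r => by
    obtain ⟨u, hu, hu'⟩ := exists_mem_uIcc_subpath_eq γ s t r
    exact ⟨u, hu, by rw [hu', hγ0]⟩) 0 1
  rw [hp0', hp1', Path.subpath_zero_one] at h01
  have h := trans_mk_cast_eq γ.source γ.target h01
  have hnull : ∀ p : Path z z, (∀ r, f (p r) = f z) →
      Homotopic.Quotient.mk p = Homotopic.Quotient.refl z := fun p hp =>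
    (hW (f z)).mk_eq_mk (q := Path.refl z) (fun r => by rw [hp]; exact hmem _) fun _ => hmem _
  rw [hnull (p0.cast rfl γ.source.symm) hp0, hnull (p1.cast rfl γ.target.symm) hp1,
    Homotopic.Quotient.refl_trans] at h
  exact Homotopic.Quotient.eq.1 h

/-- A surjective map whose fibres are path connected and which is locally, over the base, simple in
the sense of `IsSimpleOver` induces isomorphisms of fundamental groups. -/
theorem bijective_fundamentalGroup_map (hsurj : Function.Surjective f)
    (hfib : ∀ x x' : X, f x = f x' → ∃ p : Path x x', ∀ t, f (p t) = f x)
    (hloc : ∀ y, ∃ W, IsOpen W ∧ y ∈ W ∧ IsSimpleOver f W) (z : X) :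
    Function.Bijective (FundamentalGroup.map f z) := by
  constructor
  · rw [injective_iff_map_eq_one]
    intro a
    induction a using Homotopic.Quotient.ind with
    | mk γ =>
      intro h
      exact Homotopic.Quotient.eq.2 (homotopic_refl_of_map_homotopic_refl hsurj hfib hloc γ
        (Homotopic.Quotient.eq.1 h))
  · intro a
    induction a using Homotopic.Quotient.ind with
    | mk γ =>
      obtain ⟨q, hq⟩ := exists_lift_of_isSimpleOver hsurj hfib hloc γ
      exact ⟨Homotopic.Quotient.mk q, Homotopic.Quotient.eq.2 hq⟩

end SimpleOver

end LocalQuaternionic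

/-! ### Spheres, annuli and boxes -/

namespace LocalQuaternionic

open Path
open scoped unitInterval

section Sphere

variable {E : Type*} [NormedAddCommGroup E] [InnerProductSpace ℝ E]

/-- The complements of two antipodal points cover the sphere; stereographic projection makes both
of them contractible, and their intersection a punctured vector space. -/
theorem simplyConnectedSpace_sphere {n : ℕ} [Fact (Module.finrank ℝ E = n + 1)] (hn : 1 < n) :
    SimplyConnectedSpace (Metric.sphere (0 : E) 1) := by
  have : Nontrivial E := Module.nontrivial_of_finrank_pos (R := ℝ) (by
    rw [Fact.out (p := Module.finrank ℝ E = n + 1)]; omega)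
  obtain ⟨v⟩ : Nonempty (Metric.sphere (0 : E) 1) :=
    (NormedSpace.sphere_nonempty.2 zero_le_one).to_subtype
  have hcompl : ∀ w : Metric.sphere (0 : E) 1, IsSimplyConnected ({w}ᶜ : Set _) := by
    intro w
    have hw := norm_eq_of_mem_sphere w
    rw [← range_stereographic_symm hw w.2, ← Set.image_univ,
      (isOpenEmbedding_stereographic_symm hw).isEmbedding.isSimplyConnected_image,
      IsSimplyConnected, (Homeomorph.Set.univ _).toHomotopyEquiv.simplyConnectedSpace_iff]
    infer_instance
  refine simplyConnectedSpace_of_isOpen_union (U := {v}ᶜ) (V := {-v}ᶜ) isOpen_compl_singleton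
    isOpen_compl_singleton ?_ (hcompl v) (hcompl (-v)) ?_
  · rw [← Set.compl_inter, Set.singleton_inter_eq_empty.2, Set.compl_empty]
    exact fun h => ne_neg_of_mem_unit_sphere ℝ v h
  · have hv := norm_eq_of_mem_sphere v
    have hv0 : (v : E) ≠ 0 := ne_zero_of_mem_unit_sphere v
    have : Module.Finite ℝ E := Module.finite_of_finrank_eq_succ
      (Fact.out (p := Module.finrank ℝ E = n + 1))
    have hrank : 1 < Module.rank ℝ (ℝ ∙ (v : E))ᗮ := by
      rw [← Module.finrank_eq_rank, Submodule.finrank_orthogonal_span_singleton (n := n) hv0]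
      exact_mod_cast hn
    have himage : ({v}ᶜ ∩ {-v}ᶜ : Set (Metric.sphere (0 : E) 1)) =
        (stereographic hv).symm '' {0}ᶜ := by
      have h := (stereographic hv).symm_image_eq_source_inter_preimage
        (s := ({0}ᶜ : Set (ℝ ∙ (v : E))ᗮ)) (Set.subset_univ _)
      rw [h, stereographic_source]
      ext x
      refine and_congr_right fun hx => ?_
      have hinj : stereographic hv x = stereographic hv (-v) ↔ x = -v :=
        (stereographic hv).injOn.eq_iff hx (ne_neg_of_mem_unit_sphere ℝ v).symm
      rw [stereographic_apply_neg] at hinj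
      exact not_congr hinj.symm
    rw [himage]
    exact (isPathConnected_compl_singleton_of_one_lt_rank hrank 0).image
      (isOpenEmbedding_stereographic_symm hv).continuous

/-- Polar coordinates on an open annulus. -/
noncomputable def annulusHomeomorph {l : ℝ} (hl : 0 ≤ l) (u : ℝ) :
    {x : E | ‖x‖ ∈ Set.Ioo l u} ≃ₜ Metric.sphere (0 : E) 1 × Set.Ioo l u where
  toFun x :=
    have hx : ‖(x : E)‖ ≠ 0 := (hl.trans_lt x.2.1).ne'
    (⟨‖(x : E)‖⁻¹ • (x : E), by simp [norm_smul, hx]⟩, ⟨‖(x : E)‖, x.2⟩)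
  invFun y := ⟨(y.2 : ℝ) • (y.1 : E), by
    have hy : 0 ≤ (y.2 : ℝ) := hl.trans y.2.2.1.le
    simpa only [Set.mem_ofPred_eq, norm_smul, norm_eq_of_mem_sphere, mul_one, Real.norm_eq_abs,
      abs_of_nonneg hy] using y.2.2⟩
  left_inv x := by
    have hx : ‖(x : E)‖ ≠ 0 := (hl.trans_lt x.2.1).ne'
    ext
    simp [smul_smul, hx]
  right_inv y := by
    have hy : 0 < (y.2 : ℝ) := hl.trans_lt y.2.2.1
    ext <;> simp [norm_smul, abs_of_pos hy, smul_smul, hy.ne']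
  continuous_toFun := by
    have h : ∀ x : {x : E | ‖x‖ ∈ Set.Ioo l u}, ‖(x : E)‖ ≠ 0 := fun x => (hl.trans_lt x.2.1).ne'
    refine .prodMk (.subtype_mk (.smul (.inv₀ ?_ h) ?_) _) (.subtype_mk ?_ _) <;> fun_prop
  continuous_invFun := by fun_prop

theorem isSimplyConnected_annulus {n : ℕ} [Fact (Module.finrank ℝ E = n + 1)] (hn : 1 < n) {l u : ℝ}
    (hl : 0 ≤ l) (hlu : l < u) : IsSimplyConnected {x : E | ‖x‖ ∈ Set.Ioo l u} := by
  have := simplyConnectedSpace_sphere (E := E) hn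
  have : ContractibleSpace (Set.Ioo l u) :=
    (convex_Ioo l u).contractibleSpace (Set.nonempty_Ioo.2 hlu)
  exact (((annulusHomeomorph hl u).toHomotopyEquiv.trans ((ContinuousMap.HomotopyEquiv.refl
    (Metric.sphere (0 : E) 1)).prodCongr (ContractibleSpace.hequiv (Set.Ioo l u) Unit).some)).trans
    (Homeomorph.prodUnique _ Unit).toHomotopyEquiv).simplyConnectedSpace

end Sphere

theorem isSimplyConnected_univ_pi {ι : Type*} {X : ι → Type*} [∀ i, TopologicalSpace (X i)]
    {s : ∀ i, Set (X i)} (h : ∀ i, IsSimplyConnected (s i)) :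
    IsSimplyConnected (Set.univ.pi s) := by
  rw [isSimplyConnected_iff_exists_homotopy_refl_forall_mem]
  refine ⟨.pi fun i => (h i).isPathConnected, fun x p hp => ?_⟩
  have hF : ∀ i, ∃ F : (p.map (continuous_apply i)).Homotopy (.refl (x i)), ∀ t, F t ∈ s i :=
    fun i => (isSimplyConnected_iff_exists_homotopy_refl_forall_mem.1 (h i)).2 _ _
      fun t => hp t i trivial
  choose F hF using hF
  exact ⟨Path.Homotopic.piHomotopy _ _ F, fun t i _ => hF i t⟩

section Box

variable {n : ℕ}

/-- The open set of points of `ℍⁿ` with `i`-th coordinate of norm within `ε` of `a i`, and nonzero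
if `a i` is nonzero: a product of balls and annuli. -/
def box (a : Fin n → ℝ) (ε : ℝ) : Set (HSpace n) :=
  Set.univ.pi fun i => {x : ℍ[ℝ] | |‖x‖ - a i| < ε ∧ (a i ≠ 0 → x ≠ 0)}

theorem isOpen_box (a : Fin n → ℝ) (ε : ℝ) : IsOpen (box a ε) := by
  refine isOpen_set_pi Set.finite_univ fun i _ => ?_
  have h1 : IsOpen {x : ℍ[ℝ] | |‖x‖ - a i| < ε} := isOpen_lt (by fun_prop) continuous_const
  by_cases h : a i = 0
  · simpa only [h, ne_eq, not_true_eq_false, false_imp_iff, and_true] using h1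
  · simpa only [h, ne_eq, not_false_eq_true, true_imp_iff] using h1.and isOpen_ne

theorem isSimplyConnected_box {a : Fin n → ℝ} (ha : ∀ i, 0 ≤ a i) {ε : ℝ} (hε : 0 < ε) :
    IsSimplyConnected (box a ε) := by
  refine isSimplyConnected_univ_pi fun i => ?_
  by_cases h : a i = 0
  · have hball : {x : ℍ[ℝ] | |‖x‖ - a i| < ε ∧ (a i ≠ 0 → x ≠ 0)} = Metric.ball 0 ε := by
      ext x
      simp [h]
    have : ContractibleSpace (Metric.ball (0 : ℍ[ℝ]) ε) :=
      (convex_ball _ _).contractibleSpace (Metric.nonempty_ball.2 hε)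
    rw [hball]
    exact SimplyConnectedSpace.ofContractible _
  · have hpos : 0 < a i := (ha i).lt_of_ne' h
    have hann : {x : ℍ[ℝ] | |‖x‖ - a i| < ε ∧ (a i ≠ 0 → x ≠ 0)} =
        {x : ℍ[ℝ] | ‖x‖ ∈ Set.Ioo (max 0 (a i - ε)) (a i + ε)} := by
      ext x
      simp only [Set.mem_ofPred_eq, h, ne_eq, not_false_eq_true, true_imp_iff, Set.mem_Ioo,
        max_lt_iff, norm_pos_iff, abs_lt]
      constructor
      · rintro ⟨⟨h1, h2⟩, h3⟩
        exact ⟨⟨h3, by linarith⟩, by linarith⟩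
      · rintro ⟨⟨h1, h2⟩, h3⟩
        exact ⟨⟨by linarith, by linarith⟩, h1⟩
    have : Fact (Module.finrank ℝ ℍ[ℝ] = 3 + 1) := ⟨Quaternion.finrank_eq_four⟩
    rw [hann]
    exact isSimplyConnected_annulus (n := 3) (by norm_num) (le_max_left _ _)
      (max_lt (by linarith) (by linarith))

end Box

end LocalQuaternionic

/-! ### Orbits of the regular representation -/

namespace LocalQuaternionic

open Path
open scoped unitInterval

section RegularRepresentation

variable {n : ℕ}

theorem norm_regularAct (q : QTorus n) (x : HSpace n) (i : Fin n) :
    ‖regularAct q x i‖ = ‖x i‖ := by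
  simp [regularAct]

/-- The continuous section `x ↦ (‖x₁‖, …, ‖xₙ‖)` of the orbit projection of `ℍⁿ`: every orbit
contains exactly one point with nonnegative real coordinates. -/
noncomputable def normPoint (x : HSpace n) : HSpace n := fun i => ((‖x i‖ : ℝ) : ℍ[ℝ])

theorem continuous_normPoint : Continuous (normPoint (n := n)) :=
  continuous_pi fun i => Quaternion.continuous_coe.comp (by fun_prop)

theorem exists_regularAct_normPoint (x : HSpace n) :
    ∃ q : QTorus n, regularAct q (normPoint x) = x := by
  have h : ∀ i, ∃ q : Metric.sphere (0 : ℍ[ℝ]) 1, (q : ℍ[ℝ]) * ((‖x i‖ : ℝ) : ℍ[ℝ]) = x i := by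
    intro i
    by_cases hx : x i = 0
    · exact ⟨1, by simp [hx]⟩
    · refine ⟨⟨‖x i‖⁻¹ • x i, by simp [norm_smul, hx]⟩, ?_⟩
      rw [Quaternion.mul_coe_eq_smul, smul_smul, mul_inv_cancel₀ (norm_ne_zero_iff.2 hx), one_smul]
  choose q hq using h
  exact ⟨q, funext hq⟩

instance pathConnectedSpace_qTorus : PathConnectedSpace (QTorus n) := by
  have : PathConnectedSpace (Metric.sphere (0 : ℍ[ℝ]) 1) :=
    isPathConnected_iff_pathConnectedSpace.1 (isPathConnected_sphere (by
      rw [Quaternion.rank_eq_four]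
      norm_num) 0 zero_le_one)
  infer_instance

end RegularRepresentation

/-! ### The orbit map of a weakly regular atlas -/

namespace WeaklyRegularAtlas

variable {n : ℕ} {r : ℕ∞} {M : Type*} [TopologicalSpace M] (A : WeaklyRegularAtlas n r M)

theorem isInvariant_target {φ : OpenPartialHomeomorph M (HSpace n)} (hφ : φ ∈ A.charts) :
    IsInvariant φ.target := by
  have h := (A.overlap φ hφ φ hφ).1
  have h' : (φ.symm.trans φ).source = φ.target := by
    ext x
    simp +contextual
  rwa [h'] at h

/-- The orbit of a point in a chart `ψ` is contained in every chart `φ` around that point, and is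
also an orbit in `φ`: the overlap is invariant and the overlap map equivariant. -/
theorem exists_regularAct_of_localOrbitMap_eq {φ ψ : OpenPartialHomeomorph M (HSpace n)}
    (hφ : φ ∈ A.charts) (hψ : ψ ∈ A.charts) {x y : ψ.source}
    (h : localOrbitMap ψ x = localOrbitMap ψ y) (hx : (x : M) ∈ φ.source) :
    (y : M) ∈ φ.source ∧ ∃ q : QTorus n, regularAct q (φ x) = φ y := by
  obtain ⟨q, hq : regularAct q (ψ x) = ψ y⟩ := Quotient.exact h
  obtain ⟨hinv, -, -, -, ρ, hρ⟩ := A.overlap φ hφ ψ hψ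
  have hxs : ψ x ∈ (ψ.symm.trans φ).source := by
    rw [OpenPartialHomeomorph.trans_source]
    exact ⟨ψ.map_source x.2, by rwa [Set.mem_preimage, ψ.left_inv x.2]⟩
  have hys := hinv q _ hxs
  have hxy := hρ q _ hxs
  rw [hq] at hys hxy
  rw [OpenPartialHomeomorph.trans_source] at hys
  rw [OpenPartialHomeomorph.coe_trans, Function.comp_apply, Function.comp_apply, ψ.left_inv x.2,
    ψ.left_inv y.2] at hxy
  have hy := hys.2
  rw [Set.mem_preimage, ψ.left_inv y.2] at hy
  exact ⟨hy, ρ q, hxy.symm⟩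

/-- A fibre of the orbit map that meets a chart is a single orbit in that chart. -/
theorem exists_regularAct_of_orbitFun_eq {φ : OpenPartialHomeomorph M (HSpace n)}
    (hφ : φ ∈ A.charts) {x y : M} (hx : x ∈ φ.source) (h : A.orbitFun x = A.orbitFun y) :
    y ∈ φ.source ∧ ∃ q : QTorus n, regularAct q (φ x) = φ y := by
  -- `P` says that a local orbit corresponds to the orbit of `φ x`; it respects `A.orbRel`.
  let P : (Σ φ : A.charts, LocalOrbitSpace (φ : OpenPartialHomeomorph M (HSpace n))) → Prop :=
    fun a => ∃ z : a.1.1.source, a.2 = localOrbitMap a.1.1 z ∧ (z : M) ∈ φ.source ∧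
      ∃ q : QTorus n, regularAct q (φ x) = φ z
  have hP : ∀ a b, A.orbRel a b → P a → P b := by
    rintro a b ⟨w, hwa, hwb, ha, hb⟩ ⟨z, hz, hzφ, q, hq⟩
    obtain ⟨hw, q', hq'⟩ := A.exists_regularAct_of_localOrbitMap_eq hφ a.1.2
      (x := z) (y := ⟨w, hwa⟩) (hz.symm.trans ha) hzφ
    exact ⟨⟨w, hwb⟩, hb, hw, q' * q, by rw [regularAct_mul, hq, hq']⟩
  have hsymm : ∀ a b, A.orbRel a b → A.orbRel b a := fun a b ⟨w, hwa, hwb, ha, hb⟩ =>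
    ⟨w, hwb, hwa, hb, ha⟩
  let P' : A.OrbitSpace → Prop :=
    Quot.lift P fun a b hab => propext ⟨hP a b hab, hP b a (hsymm a b hab)⟩
  have hPx : P' (A.orbitFun x) := ⟨⟨x, _⟩, rfl, hx, 1, regularAct_one _⟩
  rw [h] at hPx
  obtain ⟨z, hz, hzφ, q, hq⟩ := hPx
  obtain ⟨hy, q', hq'⟩ := A.exists_regularAct_of_localOrbitMap_eq hφ
    (A.covers y).choose_spec.1 (x := z) (y := ⟨y, (A.covers y).choose_spec.2⟩) hz.symm hzφ
  exact ⟨hy, q' * q, by rw [regularAct_mul, hq, hq']⟩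

theorem orbitFun_eq_of_regularAct {φ : OpenPartialHomeomorph M (HSpace n)}
    (hφ : φ ∈ A.charts) {x y : M} (hx : x ∈ φ.source) (hy : y ∈ φ.source) {q : QTorus n}
    (h : regularAct q (φ x) = φ y) : A.orbitFun x = A.orbitFun y := by
  rw [A.orbitFun_eq ⟨φ, hφ⟩ ⟨x, hx⟩, A.orbitFun_eq ⟨φ, hφ⟩ ⟨y, hy⟩]
  congr 2
  exact Quotient.sound ⟨q, h⟩

theorem orbitFun_symm_regularAct {φ : OpenPartialHomeomorph M (HSpace n)}
    (hφ : φ ∈ A.charts) {z : HSpace n} (hz : z ∈ φ.target) (q : QTorus n) :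
    A.orbitFun (φ.symm (regularAct q z)) = A.orbitFun (φ.symm z) := by
  have hqz := A.isInvariant_target hφ q z hz
  refine (A.orbitFun_eq_of_regularAct hφ (φ.map_target hz) (φ.map_target hqz) (q := q) ?_).symm
  rw [φ.right_inv hz, φ.right_inv hqz]

theorem orbitFun_symm_mk {φ : A.charts} (z : φ.1.target) :
    A.orbitFun (φ.1.symm z) = Quot.mk A.orbRel ⟨φ, Quotient.mk (localOrbitSetoid φ.1) z⟩ := by
  rw [A.orbitFun_eq φ ⟨φ.1.symm z, φ.1.map_target z.2⟩]
  have h : (⟨φ.1 (φ.1.symm z), φ.1.map_source (φ.1.map_target z.2)⟩ : φ.1.target) = z :=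
    Subtype.ext (φ.1.right_inv z.2)
  rw [localOrbitMap, h]

theorem isQuotientMap_orbitFun : Topology.IsQuotientMap A.orbitFun := by
  refine ⟨Topology.isCoinducing_iff.2 fun s =>
    ⟨fun hs => ?_, fun hs => hs.preimage A.continuous_orbitFun⟩, ?_⟩
  · refine isOpen_coinduced.2 (isOpen_sigma_iff.2 fun φ => isOpen_coinduced.2 ?_)
    have hc : Continuous fun z : φ.1.target => φ.1.symm z :=
      continuousOn_iff_continuous_domRestrict.1 φ.1.continuousOn_symm
    convert hs.preimage hc using 1
    ext z
    simp only [Set.mem_preimage]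
    rw [A.orbitFun_symm_mk z]
    exact Iff.rfl
  · rintro ⟨φ, ⟨z⟩⟩
    exact ⟨φ.1.symm z, A.orbitFun_symm_mk z⟩

/-- Points of the same orbit are joined by a path in the orbit, because `Qⁿ` is path connected. -/
theorem exists_path_of_orbitMap_eq (x y : M) (h : A.orbitMap x = A.orbitMap y) :
    ∃ p : Path x y, ∀ t, A.orbitMap (p t) = A.orbitMap x := by
  obtain ⟨φ, hφ, hx⟩ := A.covers x
  obtain ⟨hy, q, hq⟩ := A.exists_regularAct_of_orbitFun_eq hφ hx h
  let γ : Path (1 : QTorus n) q := PathConnectedSpace.somePath 1 q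
  have hφx := φ.map_source hx
  have hc : Continuous fun t => φ.symm (regularAct (γ t) (φ x)) := by
    refine φ.continuousOn_symm.comp_continuous ?_ fun t => A.isInvariant_target hφ _ _ hφx
    unfold regularAct
    fun_prop
  refine ⟨⟨⟨_, hc⟩, ?_, ?_⟩, fun t => ?_⟩
  · simp [regularAct_one, hx]
  · simp [hq, hy]
  · exact (A.orbitFun_symm_regularAct hφ hφx _).trans (congrArg A.orbitFun (φ.left_inv hx))

/-- Boxes in a chart around a point give neighbourhoods in the orbit space over which the orbit map
is simple. -/
theorem exists_isSimpleOver (y : A.OrbitSpace) :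
    ∃ W, IsOpen W ∧ y ∈ W ∧ IsSimpleOver A.orbitMap W := by
  obtain ⟨x, rfl⟩ := A.isQuotientMap_orbitFun.surjective y
  obtain ⟨φ, hφ, hx⟩ := A.covers x
  have hinv := A.isInvariant_target hφ
  have htarget : ∀ z, normPoint z ∈ φ.target ↔ z ∈ φ.target := by
    intro z
    obtain ⟨q, hq⟩ := exists_regularAct_normPoint z
    refine ⟨fun h => hq ▸ hinv q _ h, fun h => ?_⟩
    have := hinv q⁻¹ _ h
    rwa [← hq, ← regularAct_mul, inv_mul_cancel, regularAct_one] at this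
  obtain ⟨ε, hε, hball⟩ := Metric.isOpen_iff.1 φ.open_target _ ((htarget _).2 (φ.map_source hx))
  set N := box (fun i => ‖φ x i‖) ε with hN
  have hNtarget : N ⊆ φ.target := by
    intro z hz
    refine (htarget z).1 (hball ?_)
    rw [Metric.mem_ball, dist_pi_lt_iff hε]
    intro i
    rw [dist_eq_norm, normPoint, normPoint, ← Quaternion.coe_sub, Quaternion.norm_coe,
      Real.norm_eq_abs]
    exact (hz i trivial).1
  have hNinv : ∀ z z', (∀ i, ‖z i‖ = ‖z' i‖) → z ∈ N → z' ∈ N := by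
    intro z z' h hz i hi
    refine ⟨h i ▸ (hz i hi).1, fun h' => ?_⟩
    rw [← norm_ne_zero_iff, ← h i, norm_ne_zero_iff]
    exact (hz i hi).2 h'
  set S := φ.source ∩ φ ⁻¹' N with hS
  have hSopen : IsOpen S := φ.isOpen_inter_preimage (isOpen_box _ _)
  have hnorm : ∀ {m m' : M}, m ∈ φ.source → A.orbitFun m = A.orbitFun m' →
      ∀ i, ‖φ m i‖ = ‖φ m' i‖ := by
    intro m m' hm h i
    obtain ⟨-, q, hq⟩ := A.exists_regularAct_of_orbitFun_eq hφ hm h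
    rw [← hq, norm_regularAct]
  -- `S` is saturated.
  have hpre : A.orbitFun ⁻¹' (A.orbitFun '' S) = S := by
    refine (Set.subset_preimage_image _ _).antisymm' ?_
    rintro m' ⟨m, hm, h⟩
    exact ⟨(A.exists_regularAct_of_orbitFun_eq hφ hm.1 h).1, hNinv _ _ (hnorm hm.1 h) hm.2⟩
  have hWopen : IsOpen (A.orbitFun '' S) := by
    rwa [← A.isQuotientMap_orbitFun.isOpen_preimage, hpre]
  have hxS : x ∈ S := by
    refine ⟨hx, fun i _ => ⟨by simpa using hε, fun h => ?_⟩⟩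
    rwa [← norm_ne_zero_iff]
  have hsc : IsSimplyConnected S := by
    have himage : φ '' S = N := by
      rw [hS, φ.image_source_inter_eq', φ.target_inter_inv_preimage_preimage,
        Set.inter_eq_right.2 hNtarget]
    have hNsc : IsSimplyConnected N := isSimplyConnected_box (fun i => norm_nonneg _) hε
    exact ((φ.homeomorphOfImageSubsetSource Set.inter_subset_left
      himage).toHomotopyEquiv.simplyConnectedSpace_iff).2 hNsc
  refine ⟨A.orbitFun '' S, hWopen, ⟨x, hxS, rfl⟩, ⟨?_, fun hp hq => hsc.mk_eq_mk ?_ ?_⟩⟩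
  · obtain ⟨τ, hτ⟩ := A.isQuotientMap_orbitFun.surjective.hasRightInverse
    have hτS : ∀ w ∈ A.orbitFun '' S, τ w ∈ S := by
      intro w hw
      rwa [← hpre, Set.mem_preimage, hτ]
    refine ⟨fun w => φ.symm (normPoint (φ (τ w))), ?_, fun w hw => ?_⟩
    · rw [A.isQuotientMap_orbitFun.continuousOn_isOpen_iff hWopen, hpre]
      have hc : ContinuousOn (fun m => φ.symm (normPoint (φ m))) S :=
        φ.continuousOn_symm.comp (continuous_normPoint.comp_continuousOn
          (φ.continuousOn.mono Set.inter_subset_left))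
          fun m hm => (htarget _).2 (φ.map_source hm.1)
      refine hc.congr fun m hm => ?_
      have : normPoint (φ (τ (A.orbitFun m))) = normPoint (φ m) := funext fun i => by
        rw [normPoint, normPoint, hnorm hm.1 (hτ (A.orbitFun m)).symm i]
      exact congrArg φ.symm this
    · have hm := hτS w hw
      obtain ⟨q, hq⟩ := exists_regularAct_normPoint (φ (τ w))
      have := A.orbitFun_symm_regularAct hφ ((htarget _).2 (φ.map_source hm.1)) q
      rw [hq, φ.left_inv hm.1, hτ] at this
      exact this.symm
  · exact fun t => hpre ▸ hp t
  · exact fun t => hpre ▸ hq t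

end WeaklyRegularAtlas

end LocalQuaternionic

theorem proposition3p3 {n : ℕ} {r : ℕ∞} {M : Type*} [TopologicalSpace M] [CompactSpace M]
    [T2Space M] [ConnectedSpace M] (A : LocalQuaternionic.WeaklyRegularAtlas n r M) (x₀ : M) :
    Function.Bijective (FundamentalGroup.map A.orbitMap x₀) :=
  LocalQuaternionic.bijective_fundamentalGroup_map A.isQuotientMap_orbitFun.surjective
    A.exists_path_of_orbitMap_eq A.exists_isSimpleOver x₀
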